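/- Let $d\ge 2$ be an integer and let $G$ be a finite simple graph (not necessarily connected) in which every vertex has degree $2d$ or $2d+2$. Then $G$ admits an antimagic orientation; that is, one can choose a direction for every edge of $G$ so that, for the resulting digraph $D$ with arc set $A(D)$, there is a bijection $c:A(D)\to\{1,2,\dots,|A(D)|\}$ for which the vertex sums $$S(u)=\sum_{a\in A(D)\text{ entering }u}c(a)\;-\sum_{a\in A(D)\text{ leaving }u}c(a),\qquad u\in V(G),$$ are pairwise distinct. -/

import Mathlib

/-- `D` is an orientation of the simple graph `G`: every edge of `G` receives exactly one of its
two directions, and `D` has no other arcs (in particular no loops). -/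
structure Digraph.IsOrientationOf {V : Type*} (D : Digraph V) (G : SimpleGraph V) : Prop where
  adj_iff : ∀ u v, G.Adj u v ↔ D.Adj u v ∨ D.Adj v u
  asymm : ∀ u v, D.Adj u v → ¬ D.Adj v u

/-- The arc set of `D`; the pair `(u, v)` is the arc leaving `u` and entering `v`. -/
def Digraph.arcSet {V : Type*} (D : Digraph V) : Set (V × V) :=
  {a | D.Adj a.1 a.2}

open Classical in
/-- The sum of the labels of all arcs entering `u` minus the sum of the labels of all arcs
leaving `u`. Values of `c` at pairs that are not arcs of `D` play no role. -/
noncomputable def Digraph.vertexSum {V : Type*} [Fintype V] (D : Digraph V) (c : V × V → ℕ)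
    (u : V) : ℤ :=
  (∑ w : V with D.Adj w u, (c (w, u) : ℤ)) - ∑ w : V with D.Adj u w, (c (u, w) : ℤ)

/-- `c` restricts to a bijection from the arcs of `D` onto `{1, …, |A(D)|}`, and distinct
vertices have distinct vertex sums. -/
structure Digraph.IsAntimagicLabeling {V : Type*} [Fintype V] (D : Digraph V)
    (c : V × V → ℕ) : Prop where
  bijOn : Set.BijOn c D.arcSet (Set.Icc 1 D.arcSet.ncard)
  injective : Function.Injective (D.vertexSum c)

/-- A digraph is antimagic if it has an antimagic labeling. -/
def Digraph.IsAntimagic {V : Type*} [Fintype V] (D : Digraph V) : Prop :=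
  ∃ c : V × V → ℕ, D.IsAntimagicLabeling c

/-- Some orientation of `G` is antimagic. -/
def SimpleGraph.HasAntimagicOrientation {V : Type*} [Fintype V] (G : SimpleGraph V) : Prop :=
  ∃ D : Digraph V, D.IsOrientationOf G ∧ D.IsAntimagic

/-! All degrees are even, so every component has an Eulerian circuit. Choosing one departure of the
circuit at each vertex cuts it into trails, one starting and one ending at each vertex; `next` maps
the start of a trail to its end and has one cycle per component (`nonempty_trailSystem`). Each trail
receives a block of consecutive labels, increasing in the direction given to the trail. Each passage
of a trail through a vertex then contributes -1, so only the two end edges at each vertex and a term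
-(d-1) or -d matter.

Directing the trails of a cycle alternately makes vertices at odd positions sources and those at
even positions sinks of their two end edges. Only position 0 of an odd cycle is exceptional, with
one end edge of each kind. Sums of sinks exceed exceptional sums, and these exceed sums of sources.
Two sources, or two sinks, are separated if the trails at one can be matched with later trails at
the other (`PairLT`): two matches shift the sum by at least 2, while the passages account for at
most 1. The order `trailKey` achieves this by running through each cycle from both ends towards the
middle.

For exceptional vertices the circuit is cut so that the trail leaving position 0 is a single edge.
These edges come first in the order, followed by the last two trails of every odd cycle. From one
odd cycle to the next the offset of the first trail grows by 1 and that of the last trail by at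
least 2, so the exceptional sums decrease strictly (`trailOffset_growth`), given that cycles are
sorted by the number of passages at position 0. The bound d ≥ 2 gives every cycle at least five
vertices, as the layers of odd cycles require. -/

/-! ### Eulerian circuits as permutations of arcs. -/

/-- A finite set of even cardinality carries a fixed-point-free involution. -/
theorem Finset.exists_fixedPointFree_involution {α : Type*} (s : Finset α) (h : Even s.card) :
    ∃ g : α → α, ∀ x ∈ s, g x ∈ s ∧ g x ≠ x ∧ g (g x) = x := by
  classical
  obtain ⟨k, hk⟩ := h
  let e : s ≃ Fin k ⊕ Fin k := (s.equivFinOfCardEq hk).trans finSumFinEquiv.symm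
  refine ⟨fun x => if hx : x ∈ s then (e.symm (e ⟨x, hx⟩).swap : s) else x, fun x hx => ?_⟩
  have hmem : ((e.symm (e ⟨x, hx⟩).swap : s) : α) ∈ s := Subtype.property _
  simp only [hx, dif_pos, hmem, Subtype.coe_eta, Equiv.apply_symm_apply, Sum.swap_swap,
    Equiv.symm_apply_apply, and_true, true_and]
  intro h
  have h' : e.symm (e ⟨x, hx⟩).swap = ⟨x, hx⟩ := Subtype.ext h
  rw [Equiv.symm_apply_eq] at h'
  rcases hy : e ⟨x, hx⟩ with y | y <;> simp [hy] at h'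

/-- Composing with a transposition of two elements of different cycles joins these cycles. -/
theorem Equiv.Perm.sameCycle_swap_mul {α : Type*} [Fintype α] [DecidableEq α] (σ : Equiv.Perm α)
    {a b : α} (hab : ¬ σ.SameCycle a b) : (Equiv.swap a b * σ).SameCycle a b := by
  classical
  have hex : ∃ n, 0 < n ∧ (σ ^ n) a = a :=
    ⟨orderOf σ, orderOf_pos σ, by rw [pow_orderOf_eq_one]; rfl⟩
  obtain ⟨hn, hna⟩ := Nat.find_spec hex
  have hmin : ∀ i, 0 < i → i < Nat.find hex → (σ ^ i) a ≠ a :=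
    fun i hi hlt h => Nat.find_min hex hlt ⟨hi, h⟩
  generalize Nat.find hex = n at hn hna hmin
  -- Before its first return to `a` the orbit of `a` under `σ` meets neither `a` nor `b`, so the
  -- swap acts only at the return, which it redirects to `b`.
  have key : ∀ i < n, ((Equiv.swap a b * σ) ^ i) a = (σ ^ i) a := by
    intro i
    induction i with
    | zero => simp
    | succ i ih =>
      intro hi
      rw [pow_succ', Equiv.Perm.mul_apply, ih (by omega), Equiv.Perm.mul_apply,
        ← Equiv.Perm.mul_apply σ, ← pow_succ', Equiv.swap_apply_of_ne_of_ne]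
      · exact hmin _ (by omega) hi
      · exact fun h => hab ⟨(i + 1 : ℕ), by rw [zpow_natCast]; exact h⟩
  refine ⟨(n : ℕ), ?_⟩
  obtain ⟨m, rfl⟩ : ∃ m, n = m + 1 := ⟨n - 1, by omega⟩
  rw [zpow_natCast, pow_succ', Equiv.Perm.mul_apply, key m (by omega), Equiv.Perm.mul_apply,
    ← Equiv.Perm.mul_apply σ, ← pow_succ', hna, Equiv.swap_apply_left]

theorem Equiv.Perm.SameCycle.of_forall_apply {α : Type*} {σ ρ : Equiv.Perm α}
    (h : ∀ c, ρ.SameCycle c (σ c)) {c d : α} (hcd : σ.SameCycle c d) : ρ.SameCycle c d := by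
  obtain ⟨n, rfl⟩ := hcd
  induction n with
  | zero => exact Equiv.Perm.SameCycle.refl _ _
  | succ n ih =>
    refine ih.trans ?_
    have := h ((σ ^ (n : ℤ)) c)
    rwa [← Equiv.Perm.mul_apply σ, ← zpow_one_add, add_comm] at this
  | pred n ih =>
    refine ih.trans ?_
    have := h ((σ ^ (-(n : ℤ) - 1)) c)
    rw [← Equiv.Perm.mul_apply σ, ← zpow_one_add] at this
    rw [show (1 + (-(n : ℤ) - 1)) = -n by ring] at this
    exact this.symm

/-- Only the preimages of `a` and `b` get new images, and the old and new images lie in one cycle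
after the swap. -/
theorem Equiv.Perm.SameCycle.swap_mul {α : Type*} [Fintype α] [DecidableEq α] {σ : Equiv.Perm α}
    {a b : α} (hab : ¬ σ.SameCycle a b) {c d : α} (hcd : σ.SameCycle c d) :
    (Equiv.swap a b * σ).SameCycle c d := by
  have hab' := Equiv.Perm.sameCycle_swap_mul σ hab
  refine Equiv.Perm.SameCycle.of_forall_apply (fun c => ?_) hcd
  have h1 : (Equiv.swap a b * σ).SameCycle c (Equiv.swap a b (σ c)) := ⟨1, by simp⟩
  by_cases ha : σ c = a
  · rw [ha, Equiv.swap_apply_left] at h1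
    rw [ha]
    exact h1.trans hab'.symm
  by_cases hb : σ c = b
  · rw [hb, Equiv.swap_apply_right] at h1
    rw [hb]
    exact h1.trans hab'
  rwa [Equiv.swap_apply_of_ne_of_ne ha hb] at h1

namespace SimpleGraph

variable {V : Type*} [Fintype V] (G : SimpleGraph V) [DecidableRel G.Adj]

/-- A graph with even degrees has an orientation, given by a set `A` of darts, whose arcs are
permuted in such a way that every arc is followed by an arc leaving its head. -/
theorem exists_orientation_perm (heven : ∀ v, Even (G.degree v)) :
    ∃ (A : Set G.Dart) (σ : Equiv.Perm A), (∀ d, d ∈ A ↔ d.symm ∉ A) ∧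
      ∀ a : A, (σ a).1.fst = a.1.snd := by
  classical
  choose g hg using fun v => (G.neighborFinset v).exists_fixedPointFree_involution
    (by rw [card_neighborFinset_eq_degree]; exact heven v)
  simp only [mem_neighborFinset] at hg
  let p : G.Dart → G.Dart := fun d => ⟨(d.fst, g d.fst d.snd), (hg _ _ d.adj).1⟩
  have hp : Function.Involutive p := fun d => by
    ext
    · rfl
    · exact (hg _ _ d.adj).2.2
  have hp' : ∀ d, p d ≠ d := fun d h =>
    (hg _ _ d.adj).2.1 (congrArg (fun e : G.Dart => e.snd) h)
  have hs : Function.Involutive (Dart.symm (G := G)) := Dart.symm_involutive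
  -- `ρ` follows a dart to its head and leaves along the partner of the edge just used. Its cycles
  -- are closed trails, and reversing darts runs them backwards.
  let ρ : Equiv.Perm G.Dart := hs.toPerm.trans hp.toPerm
  have hρ : ∀ d, ρ d = p d.symm := fun d => rfl
  have hρs : ∀ d, ρ (ρ d).symm = d.symm := fun d => by
    rw [hρ, hρ, hs, hp]
  -- Peeling one step off both ends lowers `n` by 2, until a dart equals its reverse or an edge is
  -- its own partner.
  have hne : ∀ (n : ℕ) (d : G.Dart), (ρ ^ n) d ≠ d.symm := by
    intro n
    induction n using Nat.strong_induction_on with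
    | _ n ih =>
      intro d h
      match n, ih, h with
      | 0, _, h => exact d.symm_ne h.symm
      | 1, _, h => exact hp' d.symm h
      | n + 2, ih, h =>
        refine ih n (by omega) (ρ d) ?_
        apply ρ.injective
        rw [hρs, ← h, ← Equiv.Perm.mul_apply, ← Equiv.Perm.mul_apply, ← pow_succ', ← pow_succ]
  have hnot : ∀ d, ¬ ρ.SameCycle d d.symm := fun d h => by
    obtain ⟨n, -, hn⟩ := h.exists_pow_eq'
    exact hne n d hn
  let q : G.Dart → Quotient (Equiv.Perm.SameCycle.setoid ρ) := Quotient.mk _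
  have hq : ∀ d e, q d = q e ↔ ρ.SameCycle d e := fun d e => Quotient.eq
  -- No cycle is its own reverse, so any linear order on the cycles selects one of each pair of
  -- opposite cycles.
  let _ : LinearOrder (Quotient (Equiv.Perm.SameCycle.setoid ρ)) :=
    LinearOrder.lift' (Fintype.equivFin _) (Equiv.injective _)
  have h1 : ∀ d, q (ρ d) = q d := fun d => (hq _ _).2 ⟨-1, by simp⟩
  have h2 : ∀ d, q (ρ d).symm = q d.symm := fun d => by
    rw [← h1 (ρ d).symm, hρs]
  refine ⟨{d | q d < q d.symm}, ρ.subtypePerm fun d => ?_, fun d => ?_, fun a => rfl⟩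
  · simp only [Set.mem_ofPred_eq, h1, h2]
  · have : q d ≠ q d.symm := fun h => hnot d ((hq _ _).1 h)
    simp only [Set.mem_ofPred_eq, Dart.symm_symm, not_lt]
    exact ⟨le_of_lt, fun h => lt_of_le_of_ne h this⟩

/-- The Eulerian circuits of the components of a graph with even degrees. -/
theorem exists_orientation_perm_sameCycle (heven : ∀ v, Even (G.degree v)) :
    ∃ (A : Set G.Dart) (σ : Equiv.Perm A), (∀ d, d ∈ A ↔ d.symm ∉ A) ∧
      (∀ a : A, (σ a).1.fst = a.1.snd) ∧
      ∀ a b : A, a.1.fst = b.1.fst → σ.SameCycle a b := by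
  classical
  obtain ⟨A, σ₀, hA, hσ₀⟩ := G.exists_orientation_perm heven
  let P : Finset (Equiv.Perm A) := {σ | ∀ a : A, (σ a).1.fst = a.1.snd}
  -- Among all admissible successor permutations take one with the most pairs in a common cycle:
  -- swapping two arcs with the same tail in different cycles would give an admissible one with
  -- more.
  let w : Equiv.Perm A → ℕ := fun σ => Finset.card {x : A × A | σ.SameCycle x.1 x.2}
  obtain ⟨σ, hσ, hmax⟩ := P.exists_max_image w ⟨σ₀, by simpa [P] using hσ₀⟩
  have hσ' : ∀ a : A, (σ a).1.fst = a.1.snd := by simpa [P] using hσ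
  refine ⟨A, σ, hA, hσ', fun a b hab => ?_⟩
  by_contra hcyc
  have hmem : Equiv.swap a b * σ ∈ P := by
    simp only [P, Finset.mem_filter, Finset.mem_univ, true_and]
    intro c
    rw [Equiv.Perm.mul_apply, ← hσ' c]
    by_cases ha : σ c = a
    · rw [ha, Equiv.swap_apply_left, hab]
    by_cases hb : σ c = b
    · rw [hb, Equiv.swap_apply_right, hab]
    rw [Equiv.swap_apply_of_ne_of_ne ha hb]
  refine absurd (hmax _ hmem) (not_le.2 (Finset.card_lt_card ?_))
  rw [Finset.ssubset_iff_of_subset]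
  · exact ⟨(a, b), by simpa using Equiv.Perm.sameCycle_swap_mul σ hcyc, by simpa using hcyc⟩
  · intro x hx
    simp only [Finset.mem_filter, Finset.mem_univ, true_and] at hx ⊢
    exact hx.swap_mul hcyc

end SimpleGraph

/-! ### Cutting the circuits into trails. -/

/-- The first return map of a permutation to a set that meets all its cycles, together with the
return times. -/
theorem Equiv.Perm.exists_firstReturn {A V : Type*} [Finite A] [Finite V] (σ : Equiv.Perm A)
    {f : V → A} (hf : Function.Injective f) (h : ∀ a, ∃ v, σ.SameCycle a (f v)) :
    ∃ (τ : Equiv.Perm V) (l : V → ℕ), (∀ v, 0 < l v) ∧ (∀ v, (σ ^ l v) (f v) = f (τ v)) ∧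
      (∀ v i, 0 < i → i < l v → (σ ^ i) (f v) ∉ Set.range f) ∧
      (∀ a, ∃ v i, i < l v ∧ (σ ^ i) (f v) = a) ∧
      (∀ v w i j, i < l v → j < l w → (σ ^ i) (f v) = (σ ^ j) (f w) → v = w ∧ i = j) ∧
      ∀ v w, σ.SameCycle (f v) (f w) → τ.SameCycle v w := by
  classical
  have hex : ∀ v, ∃ n, 0 < n ∧ (σ ^ n) (f v) ∈ Set.range f := fun v =>
    ⟨orderOf σ, orderOf_pos σ, v, by rw [pow_orderOf_eq_one]; rfl⟩
  let l : V → ℕ := fun v => Nat.find (hex v)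
  have hl : ∀ v, 0 < l v := fun v => (Nat.find_spec (hex v)).1
  have hmin : ∀ v i, 0 < i → i < l v → (σ ^ i) (f v) ∉ Set.range f :=
    fun v i hi hlt hm => Nat.find_min (hex v) hlt ⟨hi, hm⟩
  choose t ht using fun v => (Nat.find_spec (hex v)).2
  have ht' : ∀ v, (σ ^ l v) (f v) = f (t v) := fun v => (ht v).symm
  have cancel : ∀ v w i j, i ≤ j → (σ ^ i) (f v) = (σ ^ j) (f w) →
      f v = (σ ^ (j - i)) (f w) := by
    intro v w i j hij he
    apply (σ ^ i).injective
    rw [he, ← Equiv.Perm.mul_apply, ← pow_add]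
    congr 2
    omega
  -- Running both orbits back by `i` steps puts `f v` on the orbit of `f w` before its return time,
  -- hence at its start.
  have hle : ∀ v w i j, i ≤ j → j < l w → (σ ^ i) (f v) = (σ ^ j) (f w) → v = w ∧ i = j := by
    intro v w i j hij hj he
    have he' := cancel v w i j hij he
    have h0 : j - i = 0 := by
      by_contra h0
      exact hmin w (j - i) (by omega) (by omega) ⟨v, he'⟩
    rw [h0] at he'
    exact ⟨hf he', by omega⟩
  have htle : ∀ v w, l v ≤ l w → t v = t w → v = w := by
    intro v w hvw he
    have he' := cancel v w (l v) (l w) hvw (by rw [ht', ht', he])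
    have h0 : l w - l v = 0 := by
      by_contra h0
      exact hmin w (l w - l v) (by omega) (by have := hl v; omega) ⟨v, he'⟩
    rw [h0] at he'
    exact hf he'
  have htinj : Function.Injective t := fun v w he =>
    (le_total (l v) (l w)).elim (fun hvw => htle v w hvw he) fun hvw => (htle w v hvw he.symm).symm
  let τ : Equiv.Perm V := Equiv.ofBijective t (Finite.injective_iff_bijective.1 htinj)
  have hτ : ∀ v, τ v = t v := fun v => rfl
  refine ⟨τ, l, hl, ht', hmin, fun a => ?_, fun v w i j hi hj he => ?_, fun v w hvw => ?_⟩
  · obtain ⟨v, hv⟩ := h a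
    obtain ⟨n, -, hn⟩ := hv.symm.exists_pow_eq'
    clear hv
    induction n using Nat.strong_induction_on generalizing v with
    | _ n ih =>
      by_cases hlt : n < l v
      · exact ⟨v, n, hlt, hn⟩
      · refine ih (n - l v) (by have := hl v; omega) (t v) ?_
        rw [← ht', ← Equiv.Perm.mul_apply, ← pow_add, ← hn]
        congr 2
        omega
  · rcases le_total i j with hij | hij
    · exact hle v w i j hij hj he
    · obtain ⟨h1, h2⟩ := hle w v j i hij hi he.symm
      exact ⟨h1.symm, h2.symm⟩
  · obtain ⟨n, -, hn⟩ := hvw.exists_pow_eq'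
    clear hvw
    induction n using Nat.strong_induction_on generalizing v with
    | _ n ih =>
      rcases Nat.eq_zero_or_pos n with rfl | hpos
      · rw [hf hn]
      by_cases hlt : n < l v
      · exact absurd ⟨w, hn.symm⟩ (hmin v n hpos hlt)
      · have h1 := ih (n - l v) (by have := hl v; omega) (t v) (by
          rw [← ht', ← Equiv.Perm.mul_apply, ← pow_add, ← hn]
          congr 2
          omega)
        exact Equiv.Perm.SameCycle.trans ⟨1, by rw [zpow_one, hτ]⟩ h1

/-- A decomposition of the edges of `G` into trails, one trail starting and one trail ending at
every vertex, such that the trails of each component form a closed trail. The `i`-th vertex of the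
trail that starts at `v` is `path v i`. -/
structure SimpleGraph.TrailSystem {V : Type*} (G : SimpleGraph V) where
  next : Equiv.Perm V
  len : V → ℕ
  path : V → ℕ → V
  len_pos : ∀ v, 0 < len v
  path_zero : ∀ v, path v 0 = v
  path_len : ∀ v, path v (len v) = next v
  adj : ∀ v i, i < len v → G.Adj (path v i) (path v (i + 1))
  edge_inj : ∀ v w i j, i < len v → j < len w →
    s(path v i, path v (i + 1)) = s(path w j, path w (j + 1)) → v = w ∧ i = j
  edge_surj : ∀ u w, G.Adj u w → ∃ v i, i < len v ∧ s(path v i, path v (i + 1)) = s(u, w)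
  sameCycle : ∀ u w, G.Adj u w → next.SameCycle u w
  exists_len_one : ∀ v, ∃ w, next.SameCycle v w ∧ len w = 1

theorem SimpleGraph.nonempty_trailSystem {V : Type*} [Fintype V] (G : SimpleGraph V)
    [DecidableRel G.Adj] (heven : ∀ v, Even (G.degree v)) (hpos : ∀ v, 0 < G.degree v) :
    Nonempty G.TrailSystem := by
  classical
  obtain ⟨A, σ, hA, hσ, hcyc⟩ := G.exists_orientation_perm_sameCycle heven
  have hout : ∀ v, ∃ a : A, a.1.fst = v := by
    intro v
    obtain ⟨w, hw⟩ := (G.degree_pos_iff_exists_adj v).1 (hpos v)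
    by_cases hd : (⟨(v, w), hw⟩ : G.Dart) ∈ A
    · exact ⟨⟨_, hd⟩, rfl⟩
    · have hd' : (⟨(w, v), hw.symm⟩ : G.Dart) ∈ A := (hA _).2 hd
      exact ⟨σ ⟨_, hd'⟩, hσ _⟩
  choose o ho using hout
  -- `r` picks one arc per circuit. Cutting both at this arc and at its successor isolates it as a
  -- trail of length one; elsewhere the cut `o v` is arbitrary.
  let r : A → A := fun a => Quotient.out (Quotient.mk (Equiv.Perm.SameCycle.setoid σ) a)
  have hr : ∀ a, σ.SameCycle (r a) a := fun a =>
    Quotient.mk_out (s := Equiv.Perm.SameCycle.setoid σ) a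
  have hrr : ∀ a b, σ.SameCycle a b → r a = r b := fun a b hab =>
    congrArg Quotient.out (Quotient.sound (s := Equiv.Perm.SameCycle.setoid σ) hab)
  let f : V → A := fun v => if v = (r (o v)).1.fst then r (o v) else
    if v = (r (o v)).1.snd then σ (r (o v)) else o v
  have hf : ∀ v, (f v).1.fst = v := by
    intro v
    simp only [f]
    split_ifs with h1 h2
    · exact h1.symm
    · rw [hσ]; exact h2.symm
    · exact ho v
  have hfinj : Function.Injective f := fun v w h => by rw [← hf v, h, hf w]
  have hstep : ∀ a, σ.SameCycle a (σ a) := fun a => ⟨1, by simp⟩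
  obtain ⟨τ, l, hl, hτ, hmin, hsurj, hinj, hsame⟩ :=
    σ.exists_firstReturn hfinj fun a => ⟨a.1.fst, hcyc _ _ (hf _).symm⟩
  have hpath : ∀ v i, ((σ ^ (i + 1)) (f v)).1.fst = ((σ ^ i) (f v)).1.snd := fun v i => by
    rw [pow_succ', Equiv.Perm.mul_apply, hσ]
  have hedge : ∀ a b : A, s(a.1.fst, a.1.snd) = s(b.1.fst, b.1.snd) → a = b := by
    intro a b hab
    rcases (SimpleGraph.dart_edge_eq_iff a.1 b.1).1 hab with h | h
    · exact Subtype.ext h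
    · exact absurd (h ▸ a.2) ((hA _).1 b.2)
  refine ⟨⟨τ, l, fun v i => ((σ ^ i) (f v)).1.fst, hl, hf, fun v => ?_, fun v i _ => ?_,
    fun v w i j hi hj he => ?_, fun u w huw => ?_, fun u w huw => ?_, fun v => ?_⟩⟩
  · rw [hτ, hf]
  · rw [hpath]; exact Dart.adj _
  · rw [hpath, hpath] at he
    exact hinj v w i j hi hj (hedge _ _ he)
  · obtain ⟨a, ha⟩ : ∃ a : A, s(a.1.fst, a.1.snd) = s(u, w) := by
      by_cases hd : (⟨(u, w), huw⟩ : G.Dart) ∈ A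
      · exact ⟨⟨_, hd⟩, rfl⟩
      · exact ⟨⟨⟨(w, u), huw.symm⟩, (hA _).2 hd⟩, Sym2.eq_swap⟩
    obtain ⟨v, i, hi, rfl⟩ := hsurj a
    exact ⟨v, i, hi, by rw [hpath]; exact ha⟩
  · have key : ∀ a : A, τ.SameCycle a.1.fst a.1.snd := fun a =>
      hsame _ _ (((hcyc _ a (hf _)).trans (hstep a)).trans (hcyc _ _ ((hσ a).trans (hf _).symm)))
    by_cases hd : (⟨(u, w), huw⟩ : G.Dart) ∈ A
    · exact key ⟨_, hd⟩
    · exact (key ⟨⟨(w, u), huw.symm⟩, (hA _).2 hd⟩).symm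
  · set ρ := r (o v) with hρ
    have hρρ : r ρ = ρ := hrr _ _ (hr _)
    have h1 : f ρ.1.fst = ρ := by
      have : r (o ρ.1.fst) = ρ := (hrr _ _ (hcyc _ _ (ho _))).trans hρρ
      simp only [f, this, if_pos]
    have h2 : f ρ.1.snd = σ ρ := by
      have : r (o ρ.1.snd) = ρ :=
        ((hrr _ _ (hcyc _ _ ((ho _).trans (hσ ρ).symm))).trans (hrr _ _ (hstep ρ)).symm).trans hρρ
      have hne : ρ.1.snd ≠ ρ.1.fst := ρ.1.adj.ne'
      simp only [f, this, if_neg hne, if_pos]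
    refine ⟨ρ.1.fst, hsame _ _ ?_, ?_⟩
    · rw [h1]
      exact (hcyc _ _ ((hf v).trans (ho v).symm)).trans (hr (o v)).symm
    · by_contra hne
      refine hmin ρ.1.fst 1 one_pos (by have := hl ρ.1.fst; omega) ⟨ρ.1.snd, ?_⟩
      rw [pow_one, h1, h2]

/-! ### Positions in the cycles of trails. -/

/-- Coordinates along the cycles of a permutation: a representative of each cycle, the position
relative to the representative, and the length of the cycle. -/
structure Equiv.Perm.CycleCoordinates {V : Type*} (τ : Equiv.Perm V) where
  rep : V → V
  idx : V → ℕ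
  per : V → ℕ
  rep_eq : ∀ v w, τ.SameCycle v w → rep v = rep w
  per_eq : ∀ v w, rep v = rep w → per v = per w
  idx_lt : ∀ v, idx v < per v
  idx_apply : ∀ v, idx (τ v) = if idx v + 1 = per v then 0 else idx v + 1
  ext : ∀ v w, rep v = rep w → idx v = idx w → v = w
  rep_of_idx : ∀ v, idx v = 0 → rep v = v

/-- `P` prescribes where the numbering of each cycle may start; it will require a trail of length
one. -/
theorem Equiv.Perm.exists_cycleCoordinates {V : Type*} [Finite V] (τ : Equiv.Perm V)
    (P : V → Prop) (hP : ∀ v, ∃ w, τ.SameCycle v w ∧ P w) :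
    ∃ c : τ.CycleCoordinates, ∀ v, P (c.rep v) := by
  classical
  choose g hg hgP using hP
  let rep : V → V := fun v => g (Quotient.out (Quotient.mk (Equiv.Perm.SameCycle.setoid τ) v))
  have hrep : ∀ v w, τ.SameCycle v w → rep v = rep w := fun v w h =>
    congrArg (fun q => g (Quotient.out q)) (Quotient.sound (s := Equiv.Perm.SameCycle.setoid τ) h)
  have hrep' : ∀ v, τ.SameCycle (rep v) v := fun v =>
    (hg _).symm.trans (Quotient.mk_out (s := Equiv.Perm.SameCycle.setoid τ) v)
  let per : V → ℕ := fun v => Function.minimalPeriod τ (rep v)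
  have hper : ∀ v, 0 < per v := fun v => Function.minimalPeriod_pos_of_mem_periodicPts
    (Function.Injective.mem_periodicPts τ.injective _)
  have hex : ∀ v, ∃ n, n < per v ∧ τ^[n] (rep v) = v := by
    intro v
    obtain ⟨n, -, hn⟩ := (hrep' v).exists_pow_eq'
    refine ⟨n % per v, Nat.mod_lt _ (hper v), ?_⟩
    rw [Function.iterate_mod_minimalPeriod_eq, Equiv.Perm.iterate_eq_pow, hn]
  choose idx hidx hidx' using hex
  have huniq : ∀ v n, n < per v → τ^[n] (rep v) = v → idx v = n := fun v n hn h =>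
    Function.iterate_injOn_Iio_minimalPeriod (Set.mem_Iio.2 (hidx v)) (Set.mem_Iio.2 hn)
      ((hidx' v).trans h.symm)
  have hrτ : ∀ v, rep (τ v) = rep v := fun v => hrep _ _ ⟨-1, by simp⟩
  have hpτ : ∀ v, per (τ v) = per v := fun v => by simp only [per, hrτ]
  refine ⟨⟨rep, idx, per, hrep, fun v w h => by simp only [per, h], hidx, fun v => ?_,
    fun v w h1 h2 => ?_, fun v hv => ?_⟩, fun v => hgP _⟩
  · have h1 : τ^[idx v + 1] (rep v) = τ v := by
      rw [Function.iterate_succ_apply', hidx']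
    split_ifs with h
    · apply huniq _ _ (hper _)
      rw [h, Function.iterate_minimalPeriod] at h1
      rw [hrτ, Function.iterate_zero, id, h1]
    · exact huniq _ _ (by rw [hpτ]; have := hidx v; omega) (by rw [hrτ, h1])
  · rw [← hidx' v, ← hidx' w, h1, h2]
  · have := hidx' v
    rwa [hv] at this

/-! ### The order of the trails, in coordinates. -/

/-- The layer of the trail at position `i` of a cycle of length `k`; the trails of all cycles of
even length form the layer `B`. -/
def trailLayer (B k i : ℕ) : ℕ :=
  if k % 2 = 0 then B else if i = 0 then 0 else if k ≤ i + 2 then 1 else if i = 1 then 2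
  else 1 + min i (k - 1 - i)

/-- The position within its layer, relative to trails of the same cycle, of the trail at
position `i` of a cycle of length `k`. -/
def trailSide (k i : ℕ) : ℕ :=
  if k % 2 = 0 then if 2 * i < k then 2 * i else 2 * (k - 1 - i) + 1
  else if 2 * i < k ∨ i + 1 = k then 0 else 1

theorem trailLayer_lt {B k i : ℕ} (hk : k % 2 = 1) (h5 : 5 ≤ k) (hB : k < B) :
    trailLayer B k i < B := by
  unfold trailLayer
  split_ifs <;> omega

theorem trailLayer_even {B k i : ℕ} (hk : k % 2 = 0) : trailLayer B k i = B := by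
  unfold trailLayer
  rw [if_pos hk]

theorem trail_position_ext {B k i j : ℕ} (h5 : k % 2 = 1 → 5 ≤ k) (hi : i < k) (hj : j < k)
    (hl : trailLayer B k i = trailLayer B k j) (hs : trailSide k i = trailSide k j) : i = j := by
  unfold trailLayer at hl
  unfold trailSide at hs
  split_ifs at hl hs <;> omega

/-- The layers of the two trails at a vertex with an even position in a cycle of odd length. -/
theorem exists_layers_of_even {B k i : ℕ} (hk : k % 2 = 1) (h5 : 5 ≤ k) (hi0 : 0 < i) (hi : i < k)
    (hpar : i % 2 = 0) : ∃ h lo hi, ((lo = i - 1 ∧ hi = i) ∨ (lo = i ∧ hi = i - 1)) ∧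
      i = (if h % 2 = 0 then h else k - h) ∧ 0 < h ∧ h ≤ k ∧ trailLayer B k lo = h ∧
      trailLayer B k hi = if h = 1 then 1 else h + 1 := by
  by_cases h : 2 * i < k
  · refine ⟨i, i - 1, i, Or.inl ⟨rfl, rfl⟩, by rw [if_pos hpar], hi0, hi.le, ?_, ?_⟩ <;>
    unfold trailLayer <;> split_ifs <;> omega
  · refine ⟨k - i, i, i - 1, Or.inr ⟨rfl, rfl⟩, by rw [if_neg (by omega)]; omega, by omega,
      by omega, ?_, ?_⟩ <;>
    unfold trailLayer <;> split_ifs <;> omega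

/-- The layers of the two trails at a vertex with an odd position in a cycle of odd length. -/
theorem exists_layers_of_odd {B k i : ℕ} (hk : k % 2 = 1) (h5 : 5 ≤ k) (hi : i < k)
    (hpar : i % 2 = 1) : ∃ h lo hi, ((lo = i - 1 ∧ hi = i) ∨ (lo = i ∧ hi = i - 1)) ∧
      i = (if h % 2 = 1 then h else k - h) ∧ 0 < h ∧ h ≤ k ∧
      trailLayer B k lo = (if h ≤ 2 then h - 1 else h) ∧ trailLayer B k hi = h + 1 := by
  by_cases h : 2 * i < k
  · refine ⟨i, i - 1, i, Or.inl ⟨rfl, rfl⟩, by rw [if_pos hpar], by omega, hi.le, ?_, ?_⟩ <;>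
    unfold trailLayer <;> split_ifs <;> omega
  · refine ⟨k - i, i, i - 1, Or.inr ⟨rfl, rfl⟩, by rw [if_neg (by omega)]; omega, by omega,
      by omega, ?_, ?_⟩ <;>
    unfold trailLayer <;> split_ifs <;> omega

/-- Two pairs are comparable if one of them can be matched with strictly smaller elements of the
other. -/
def PairLT {α : Type*} [LT α] (a b c d : α) : Prop :=
  (a < c ∧ b < d) ∨ (a < d ∧ b < c)

/-- Sides number the trails in the order 0, k-1, 1, k-2, …, so the pairs at the vertices are {0,1},
{0,2}, {1,3}, {2,4}, …, {k-2,k-1}. Incomparable pairs occur only at the two ends of this list and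
belong to neighbouring vertices, which equal parity excludes. -/
theorem trailSide_pairLT {k i j p q : ℕ} (hk : k % 2 = 0) (hi : i < k) (hj : j < k) (hij : i < j)
    (hpar : i % 2 = j % 2) (hp : p = if i = 0 then k - 1 else i - 1) (hq : q + 1 = j) :
    PairLT (trailSide k p) (trailSide k i) (trailSide k q) (trailSide k j) ∨
      PairLT (trailSide k q) (trailSide k j) (trailSide k p) (trailSide k i) := by
  unfold PairLT trailSide
  simp only [if_pos hk]
  split_ifs at hp ⊢ <;> omega

/-- The sort key of a trail of the cycle number `J`. -/
def trailKey (B J k i : ℕ) : ℕ ×ₗ ℕ ×ₗ ℕ :=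
  toLex (trailLayer B k i, toLex (J, trailSide k i))

theorem trailKey_lt_iff {B J k i J' k' i' : ℕ} : trailKey B J k i < trailKey B J' k' i' ↔
    trailLayer B k i < trailLayer B k' i' ∨ trailLayer B k i = trailLayer B k' i' ∧
      (J < J' ∨ J = J' ∧ trailSide k i < trailSide k' i') := by
  simp only [trailKey, Prod.Lex.toLex_lt_toLex]

theorem trailKey_eq_iff {B J k i J' k' i' : ℕ} : trailKey B J k i = trailKey B J' k' i' ↔
    trailLayer B k i = trailLayer B k' i' ∧ J = J' ∧ trailSide k i = trailSide k' i' := by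
  simp only [trailKey, EmbeddingLike.apply_eq_iff_eq, Prod.mk.injEq]

/-- The rank `h` lists the vertices of one parity alternately from both ends of the cycle. Both
layers at a vertex depend on `h` alone and increase strictly with it, so `h` decides, and for equal
ranks the cycle number `J` does. -/
theorem trailKey_pairLT_of_odd {B J k i J' k' i' : ℕ} (hk : k % 2 = 1) (hk' : k' % 2 = 1)
    (h5 : 5 ≤ k) (h5' : 5 ≤ k') (hi : i < k) (hi' : i' < k') (hi0 : i ≠ 0) (hi0' : i' ≠ 0)
    (hpar : i % 2 = i' % 2) (hJ : J = J' → k = k' ∧ i ≠ i') :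
    PairLT (trailKey B J k (i - 1)) (trailKey B J k i)
        (trailKey B J' k' (i' - 1)) (trailKey B J' k' i') ∨
      PairLT (trailKey B J' k' (i' - 1)) (trailKey B J' k' i')
        (trailKey B J k (i - 1)) (trailKey B J k i) := by
  have main : ∃ lo hi lo' hi', ((lo = i - 1 ∧ hi = i) ∨ (lo = i ∧ hi = i - 1)) ∧
      ((lo' = i' - 1 ∧ hi' = i') ∨ (lo' = i' ∧ hi' = i' - 1)) ∧
      ((trailKey B J k lo < trailKey B J' k' lo' ∧ trailKey B J k hi < trailKey B J' k' hi') ∨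
      (trailKey B J' k' lo' < trailKey B J k lo ∧
        trailKey B J' k' hi' < trailKey B J k hi)) := by
    rcases Nat.mod_two_eq_zero_or_one i with hpi | hpi
    · obtain ⟨h, lo, hi, e1, e2, e6, e3, e4, e5⟩ :=
        exists_layers_of_even (B := B) hk h5 (by omega) hi hpi
      obtain ⟨h', lo', hi', e1', e2', e6', e3', e4', e5'⟩ :=
        exists_layers_of_even (B := B) hk' h5' (by omega) hi' (by omega)
      refine ⟨lo, hi, lo', hi', e1, e1', ?_⟩
      simp only [trailKey_lt_iff, e4, e5, e4', e5']
      clear e4 e5 e4' e5' e1 e1'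
      rcases lt_trichotomy h h' with hh | rfl | hh
      · exact Or.inl ⟨Or.inl hh, Or.inl (by split_ifs <;> omega)⟩
      · rcases lt_trichotomy J J' with hJJ | hJJ | hJJ
        · exact Or.inl ⟨Or.inr ⟨rfl, Or.inl hJJ⟩, Or.inr ⟨rfl, Or.inl hJJ⟩⟩
        · obtain ⟨rfl, hne⟩ := hJ hJJ
          exact absurd (e2.trans e2'.symm) hne
        · exact Or.inr ⟨Or.inr ⟨rfl, Or.inl hJJ⟩, Or.inr ⟨rfl, Or.inl hJJ⟩⟩
      · exact Or.inr ⟨Or.inl hh, Or.inl (by split_ifs <;> omega)⟩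
    · obtain ⟨h, lo, hi, e1, e2, e6, e3, e4, e5⟩ :=
        exists_layers_of_odd (B := B) hk h5 hi hpi
      obtain ⟨h', lo', hi', e1', e2', e6', e3', e4', e5'⟩ :=
        exists_layers_of_odd (B := B) hk' h5' hi' (by omega)
      refine ⟨lo, hi, lo', hi', e1, e1', ?_⟩
      simp only [trailKey_lt_iff, e4, e5, e4', e5']
      clear e4 e5 e4' e5' e1 e1'
      rcases lt_trichotomy h h' with hh | rfl | hh
      · exact Or.inl ⟨Or.inl (by split_ifs <;> omega), Or.inl (by omega)⟩
      · rcases lt_trichotomy J J' with hJJ | hJJ | hJJ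
        · exact Or.inl ⟨Or.inr ⟨rfl, Or.inl hJJ⟩, Or.inr ⟨rfl, Or.inl hJJ⟩⟩
        · obtain ⟨rfl, hne⟩ := hJ hJJ
          exact absurd (e2.trans e2'.symm) hne
        · exact Or.inr ⟨Or.inr ⟨rfl, Or.inl hJJ⟩, Or.inr ⟨rfl, Or.inl hJJ⟩⟩
      · exact Or.inr ⟨Or.inl (by split_ifs <;> omega), Or.inl (by omega)⟩
  obtain ⟨lo, hi, lo', hi', h1, h2, h3⟩ := main
  unfold PairLT
  rcases h1 with ⟨rfl, rfl⟩ | ⟨rfl, rfl⟩ <;> rcases h2 with ⟨rfl, rfl⟩ | ⟨rfl, rfl⟩ <;>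
    rcases h3 with h3 | h3
  · exact Or.inl (Or.inl h3)
  · exact Or.inr (Or.inl h3)
  · exact Or.inl (Or.inr h3)
  · exact Or.inr (Or.inr h3.symm)
  · exact Or.inl (Or.inr h3.symm)
  · exact Or.inr (Or.inr h3)
  · exact Or.inl (Or.inl h3.symm)
  · exact Or.inr (Or.inl h3.symm)

/-- The trails at two distinct vertices, both with even or both with odd position, where position
`0` only occurs in cycles of even length, are comparable. -/
theorem trailKey_pairLT {B J k i p J' k' i' p' : ℕ} (h5 : k % 2 = 1 → 5 ≤ k)
    (h5' : k' % 2 = 1 → 5 ≤ k') (hB : k < B) (hB' : k' < B) (hi : i < k) (hi' : i' < k')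
    (hp : p = if i = 0 then k - 1 else i - 1) (hp' : p' = if i' = 0 then k' - 1 else i' - 1)
    (h0 : i = 0 → k % 2 = 0) (h0' : i' = 0 → k' % 2 = 0) (hpar : i % 2 = i' % 2)
    (hJ : J = J' → k = k' ∧ i ≠ i') :
    PairLT (trailKey B J k p) (trailKey B J k i) (trailKey B J' k' p') (trailKey B J' k' i') ∨
      PairLT (trailKey B J' k' p') (trailKey B J' k' i') (trailKey B J k p) (trailKey B J k i) := by
  rcases Nat.mod_two_eq_zero_or_one k with hk | hk <;>
    rcases Nat.mod_two_eq_zero_or_one k' with hk' | hk'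
  · rcases lt_trichotomy J J' with h | h | h
    · left; left
      simp only [trailKey_lt_iff, trailLayer_even hk, trailLayer_even hk']
      exact ⟨Or.inr ⟨trivial, Or.inl h⟩, Or.inr ⟨trivial, Or.inl h⟩⟩
    · obtain ⟨rfl, hne⟩ := hJ h
      subst h
      simp only [PairLT, trailKey_lt_iff, trailLayer_even hk, lt_irrefl, true_and, false_or]
      rcases lt_or_gt_of_ne hne with h | h
      · exact trailSide_pairLT hk hi hi' h hpar hp (by rw [if_neg (by omega)] at hp'; omega)
      · exact (trailSide_pairLT hk hi' hi h hpar.symm hp'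
          (by rw [if_neg (by omega)] at hp; omega)).symm
    · right; left
      simp only [trailKey_lt_iff, trailLayer_even hk, trailLayer_even hk']
      exact ⟨Or.inr ⟨trivial, Or.inl h⟩, Or.inr ⟨trivial, Or.inl h⟩⟩
  · right; left
    simp only [trailKey_lt_iff, trailLayer_even hk]
    exact ⟨Or.inl (trailLayer_lt hk' (h5' hk') hB'),
      Or.inl (trailLayer_lt hk' (h5' hk') hB')⟩
  · left; left
    simp only [trailKey_lt_iff, trailLayer_even hk']
    exact ⟨Or.inl (trailLayer_lt hk (h5 hk) hB), Or.inl (trailLayer_lt hk (h5 hk) hB)⟩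
  · have hi0 : i ≠ 0 := fun h => by have := h0 h; omega
    have hi0' : i' ≠ 0 := fun h => by have := h0' h; omega
    rw [if_neg hi0] at hp
    rw [if_neg hi0'] at hp'
    subst hp hp'
    exact trailKey_pairLT_of_odd hk hk' (h5 hk) (h5' hk') hi hi' hi0 hi0' hpar hJ

/-! ### Label offsets of ordered trails. -/

section Offset

variable {V α : Type*} [Fintype V] [LinearOrder α] (key : V → α) (len : V → ℕ)

/-- The total length of all trails preceding the trail `v` in the order given by `key`. -/
def trailOffset (v : V) : ℕ :=
  ∑ w with key w < key v, len w

theorem trailOffset_add_sum_le {v w : V} {s : Finset V} (hvw : key v ≤ key w)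
    (hs : ∀ t ∈ s, key v ≤ key t ∧ key t < key w) :
    trailOffset key len v + ∑ t ∈ s, len t ≤ trailOffset key len w := by
  classical
  unfold trailOffset
  rw [← Finset.sum_union]
  · refine Finset.sum_le_sum_of_subset fun t ht => ?_
    simp only [Finset.mem_union, Finset.mem_filter, Finset.mem_univ, true_and] at ht ⊢
    exact ht.elim (fun h => h.trans_le hvw) fun h => (hs t h).2
  · rw [Finset.disjoint_left]
    intro t ht ht'
    simp only [Finset.mem_filter, Finset.mem_univ, true_and] at ht
    exact absurd ht (not_lt.2 (hs t ht').1)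

theorem trailOffset_add_sum_eq {v w : V} (hvw : key v ≤ key w) :
    trailOffset key len v + ∑ t with key v ≤ key t ∧ key t < key w, len t =
      trailOffset key len w := by
  classical
  unfold trailOffset
  rw [← Finset.sum_union]
  · congr 1
    ext t
    simp only [Finset.mem_union, Finset.mem_filter, Finset.mem_univ, true_and]
    constructor
    · exact fun h => h.elim (fun h => h.trans_le hvw) fun h => h.2
    · exact fun h => (lt_or_ge (key t) (key v)).imp id fun h' => ⟨h', h⟩
  · rw [Finset.disjoint_left]
    intro t ht ht'
    simp only [Finset.mem_filter, Finset.mem_univ, true_and] at ht ht'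
    exact absurd ht (not_lt.2 ht'.1)

theorem trailOffset_add_len_le {v w : V} (hvw : key v < key w) :
    trailOffset key len v + len v ≤ trailOffset key len w := by
  have := trailOffset_add_sum_le key len (s := {v}) hvw.le (by simpa using hvw)
  simpa using this

theorem trailOffset_add_len_le_sum (v : V) :
    trailOffset key len v + len v ≤ ∑ w, len w := by
  classical
  unfold trailOffset
  rw [add_comm, ← Finset.sum_insert (by simp)]
  exact Finset.sum_le_sum_of_subset (Finset.subset_univ _)

end Offset

/-! ### The order of the trails, on vertices. -/

namespace Equiv.Perm.CycleCoordinates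

variable {V : Type*} {τ : Equiv.Perm V} (c : τ.CycleCoordinates)

theorem rep_symm (v : V) : c.rep (τ.symm v) = c.rep v :=
  c.rep_eq _ _ ⟨1, by simp⟩

theorem per_symm (v : V) : c.per (τ.symm v) = c.per v :=
  c.per_eq _ _ (c.rep_symm v)

theorem idx_symm (v : V) :
    c.idx (τ.symm v) = if c.idx v = 0 then c.per v - 1 else c.idx v - 1 := by
  have h := c.idx_apply (τ.symm v)
  rw [Equiv.apply_symm_apply, c.per_symm] at h
  split_ifs at h ⊢ <;> omega

theorem card_le_per (v : V) (s : Finset V) (hs : ∀ w ∈ s, τ.SameCycle v w) :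
    s.card ≤ c.per v := by
  have hrep : ∀ w ∈ s, c.rep w = c.rep v := fun w hw => (c.rep_eq _ _ (hs w hw)).symm
  have := Finset.card_le_card_of_injOn (t := Finset.range (c.per v)) c.idx
    (fun w hw => by
      rw [Finset.coe_range, Set.mem_Iio, ← c.per_eq _ _ (hrep w hw)]
      exact c.idx_lt w)
    (fun w hw x hx h => c.ext _ _ ((hrep w hw).trans (hrep x hx).symm) h)
  rwa [Finset.card_range] at this

/-- The sort key of the trail starting at `v`, where `J` numbers the cycles. -/
def key (B : ℕ) (J : V → ℕ) (v : V) : ℕ ×ₗ ℕ ×ₗ ℕ :=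
  trailKey B (J v) (c.per v) (c.idx v)

variable {c} {B : ℕ} {J : V → ℕ} (h5 : ∀ v, 5 ≤ c.per v) (hB : ∀ v, c.per v < B)
  (hJ : ∀ v w, J v = J w ↔ c.rep v = c.rep w)

include h5 hJ in
theorem key_injective : Function.Injective (c.key B J) := by
  intro v w h
  obtain ⟨h1, h2, h3⟩ := trailKey_eq_iff.1 h
  have hrep := (hJ v w).1 h2
  have hper := c.per_eq _ _ hrep
  rw [← hper] at h1 h3
  exact c.ext v w hrep
    (trail_position_ext (fun _ => h5 v) (c.idx_lt v) (hper ▸ c.idx_lt w) h1 h3)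

include h5 hB hJ in
theorem key_pairLT {v w : V} (hvw : v ≠ w) (hpar : c.idx v % 2 = c.idx w % 2)
    (hv : c.idx v = 0 → c.per v % 2 = 0) (hw : c.idx w = 0 → c.per w % 2 = 0) :
    PairLT (c.key B J (τ.symm v)) (c.key B J v) (c.key B J (τ.symm w)) (c.key B J w) ∨
      PairLT (c.key B J (τ.symm w)) (c.key B J w) (c.key B J (τ.symm v)) (c.key B J v) := by
  have hJs : ∀ v, J (τ.symm v) = J v := fun v => (hJ _ _).2 (c.rep_symm v)
  unfold key
  rw [hJs, hJs, c.per_symm, c.per_symm]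
  refine trailKey_pairLT (fun _ => h5 v) (fun _ => h5 w) (hB v) (hB w) (c.idx_lt v) (c.idx_lt w)
    (c.idx_symm v) (c.idx_symm w) hv hw hpar fun h => ?_
  have hrep := (hJ v w).1 h
  exact ⟨c.per_eq _ _ hrep, fun hi => hvw (c.ext _ _ hrep hi)⟩

theorem key_lt_iff {v w : V} : c.key B J v < c.key B J w ↔
    trailLayer B (c.per v) (c.idx v) < trailLayer B (c.per w) (c.idx w) ∨
      trailLayer B (c.per v) (c.idx v) = trailLayer B (c.per w) (c.idx w) ∧
      (J v < J w ∨ J v = J w ∧ trailSide (c.per v) (c.idx v) < trailSide (c.per w) (c.idx w)) :=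
  trailKey_lt_iff

include h5 in
theorem layer_side_symm {v : V} (hi : c.idx v = 0) (hk : c.per v % 2 = 1) :
    trailLayer B (c.per (τ.symm v)) (c.idx (τ.symm v)) = 1 ∧
      trailSide (c.per (τ.symm v)) (c.idx (τ.symm v)) = 0 := by
  have := h5 v
  rw [c.per_symm, c.idx_symm, if_pos hi]
  unfold trailLayer trailSide
  constructor <;> split_ifs <;> omega

include h5 in
theorem layer_side_symm_symm {v : V} (hi : c.idx v = 0) (hk : c.per v % 2 = 1) :
    trailLayer B (c.per (τ.symm (τ.symm v))) (c.idx (τ.symm (τ.symm v))) = 1 ∧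
      trailSide (c.per (τ.symm (τ.symm v))) (c.idx (τ.symm (τ.symm v))) = 1 := by
  have := h5 v
  rw [c.per_symm, c.per_symm, c.idx_symm, c.per_symm, c.idx_symm, if_pos hi, if_neg (by omega)]
  unfold trailLayer trailSide
  constructor <;> split_ifs <;> omega

theorem layer_side_eq_zero {v : V} (hi : c.idx v = 0) (hk : c.per v % 2 = 1) :
    trailLayer B (c.per v) (c.idx v) = 0 ∧ trailSide (c.per v) (c.idx v) = 0 := by
  have := c.idx_lt v
  rw [hi] at this ⊢
  unfold trailLayer trailSide
  constructor <;> split_ifs <;> omega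

include hB in
theorem idx_eq_zero_of_layer {v : V} (h : trailLayer B (c.per v) (c.idx v) = 0) :
    c.idx v = 0 ∧ c.per v % 2 = 1 := by
  have := hB v
  unfold trailLayer at h
  split_ifs at h <;> omega

include h5 hB in
/-- At a vertex of odd position, one of the trails comes after all trails that precede a
representative of an odd cycle. -/
theorem key_symm_lt_of_odd {v w : V} (hi : c.idx v = 0) (hk : c.per v % 2 = 1)
    (hw : c.idx w % 2 = 1) :
    c.key B J (τ.symm v) < c.key B J w ∨ c.key B J (τ.symm v) < c.key B J (τ.symm w) := by
  simp only [key_lt_iff, (layer_side_symm h5 hi hk).1]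
  have h1 := h5 w
  have h2 := hB w
  have h3 := c.idx_lt w
  rw [c.per_symm w, c.idx_symm w, if_neg (by omega)]
  suffices h : 1 < trailLayer B (c.per w) (c.idx w) ∨ 1 < trailLayer B (c.per w) (c.idx w - 1) from
    h.imp Or.inl Or.inl
  unfold trailLayer
  split_ifs <;> omega

variable [Fintype V] {len : V → ℕ} (hpos : ∀ v, 0 < len v) (hone : ∀ v, len (c.rep v) = 1)

-- From `v` up to `w` the order contains only single edges, one per odd cycle. The predecessors
-- under `τ` of their starts begin trails from `τ.symm v` up to `τ.symm w`, and so does `τ.symm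
-- (τ.symm v)`, which is none of them and makes the inequality strict.
include h5 hB hJ hpos hone in
theorem trailOffset_growth {v w : V} (hv : c.idx v = 0) (hkv : c.per v % 2 = 1)
    (hw : c.idx w = 0) (hkw : c.per w % 2 = 1) (hvw : J v < J w) :
    trailOffset (c.key B J) len w + trailOffset (c.key B J) len (τ.symm v) <
      trailOffset (c.key B J) len (τ.symm w) + trailOffset (c.key B J) len v := by
  classical
  have hJs : ∀ v, J (τ.symm v) = J v := fun v => (hJ _ _).2 (c.rep_symm v)
  obtain ⟨a1, a2⟩ := layer_side_eq_zero (B := B) hv hkv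
  obtain ⟨a3, a4⟩ := layer_side_eq_zero (B := B) hw hkw
  obtain ⟨b1, b2⟩ := layer_side_symm (B := B) h5 hv hkv
  obtain ⟨b3, b4⟩ := layer_side_symm (B := B) h5 hw hkw
  obtain ⟨c1, c2⟩ := layer_side_symm_symm (B := B) h5 hv hkv
  have hlt : c.key B J v < c.key B J w := key_lt_iff.2 (Or.inr ⟨by rw [a1, a3], Or.inl hvw⟩)
  have hlt' : c.key B J (τ.symm v) < c.key B J (τ.symm w) :=
    key_lt_iff.2 (Or.inr ⟨by rw [b1, b3], Or.inl (by rwa [hJs, hJs])⟩)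
  set A : Finset V := {t | c.key B J v ≤ c.key B J t ∧ c.key B J t < c.key B J w} with hA
  have hAmem : ∀ t ∈ A, c.idx t = 0 ∧ c.per t % 2 = 1 ∧ J v ≤ J t ∧ J t < J w := by
    intro t ht
    obtain ⟨h1, h2⟩ := (Finset.mem_filter.1 ht).2
    rw [key_lt_iff, a3] at h2
    have h0 : trailLayer B (c.per t) (c.idx t) = 0 := by omega
    obtain ⟨h3, h4⟩ := idx_eq_zero_of_layer hB h0
    have h5 := (layer_side_eq_zero (B := B) h3 h4).2
    rw [← not_lt, key_lt_iff, a1, h0] at h1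
    rw [h5, a4] at h2
    exact ⟨h3, h4, by omega, by omega⟩
  have hsum : ∑ t ∈ A, len t = A.card := by
    rw [Finset.card_eq_sum_ones]
    refine Finset.sum_congr rfl fun t ht => ?_
    rw [← c.rep_of_idx t (hAmem t ht).1, hone]
  have h1 := trailOffset_add_sum_eq (c.key B J) len hlt.le
  rw [← hA, hsum] at h1
  have hnot : τ.symm (τ.symm v) ∉ A.map τ.symm.toEmbedding := by
    intro hm
    obtain ⟨t, ht, he⟩ := Finset.mem_map.1 hm
    obtain ⟨h3, h4, -⟩ := hAmem t ht
    have h6 := (layer_side_symm (B := B) h5 h3 h4).2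
    rw [Equiv.coe_toEmbedding] at he
    rw [he] at h6
    omega
  have h2 := trailOffset_add_sum_le (c.key B J) len
    (s := insert (τ.symm (τ.symm v)) (A.map τ.symm.toEmbedding)) hlt'.le (by
      intro t ht
      rw [← not_lt, key_lt_iff, key_lt_iff, b1, b2, b3, b4]
      rcases Finset.mem_insert.1 ht with rfl | ht
      · rw [c1, c2, hJs, hJs, hJs]
        omega
      · obtain ⟨t, htA, rfl⟩ := Finset.mem_map.1 ht
        obtain ⟨h3, h4, h6, h7⟩ := hAmem t htA
        obtain ⟨h8, h9⟩ := layer_side_symm (B := B) h5 h3 h4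
        rw [Equiv.coe_toEmbedding, h8, h9, hJs, hJs, hJs]
        omega)
  have h3 := Finset.card_nsmul_le_sum (insert (τ.symm (τ.symm v)) (A.map τ.symm.toEmbedding))
    (fun t => len t) 1 (fun t _ => hpos t)
  rw [Finset.card_insert_of_notMem hnot, Finset.card_map, smul_eq_mul, mul_one] at h3
  omega

end Equiv.Perm.CycleCoordinates

/-! ### Separating the vertex sums. -/

/-- The trails can be ordered and directed in such a way that the contributions of their end edges
to the vertex sums distinguish all vertices. Here `off v` is the number of labels used before the
trail from `v` to `τ v`, and `inner v` the number of passages of trails through `v`. -/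
theorem Equiv.Perm.exists_trail_order {V : Type*} [Fintype V] (τ : Equiv.Perm V)
    (len inner : V → ℕ) (e : ℕ) (hpos : ∀ v, 0 < len v) (hinner : ∀ v, inner v = e ∨ inner v = e + 1)
    (hone : ∀ v, ∃ w, τ.SameCycle v w ∧ len w = 1)
    (hcard : ∀ v, ∃ s : Finset V, 5 ≤ s.card ∧ ∀ w ∈ s, τ.SameCycle v w) :
    ∃ (off : V → ℕ) (fwd : V → Bool),
      (∀ v w, v ≠ w → off v + len v ≤ off w ∨ off w + len w ≤ off v) ∧
      (∀ v, off v + len v ≤ ∑ w, len w) ∧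
      Function.Injective fun v => -(inner v : ℤ) +
        (if fwd v then -((off v : ℤ) + 1) else (off v : ℤ) + len v) +
        (if fwd (τ.symm v) then (off (τ.symm v) : ℤ) + len (τ.symm v)
          else -((off (τ.symm v) : ℤ) + 1)) := by
  classical
  obtain ⟨c, hone'⟩ := τ.exists_cycleCoordinates (fun v => len v = 1) hone
  have h5 : ∀ v, 5 ≤ c.per v := fun v => by
    obtain ⟨s, hs, hs'⟩ := hcard v
    exact hs.trans (c.card_le_per v s hs')
  obtain ⟨B, hB⟩ : ∃ B, ∀ v, c.per v < B :=
    ⟨∑ w, c.per w + 1, fun v =>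
      Nat.lt_succ_of_le (Finset.single_le_sum (fun _ _ => Nat.zero_le _) (Finset.mem_univ v))⟩
  let E := Fintype.equivFin V
  -- Cycles are numbered by `inner` at the representative as leading digit, with `E` breaking ties.
  obtain ⟨J, hJ, hJi⟩ : ∃ J : V → ℕ, (∀ v w, J v = J w ↔ c.rep v = c.rep w) ∧
      ∀ v w, J v < J w → inner (c.rep v) ≤ inner (c.rep w) := by
    have hlt : ∀ v w, inner (c.rep v) < inner (c.rep w) →
        Fintype.card V * inner (c.rep v) + (E (c.rep v) : ℕ) <
          Fintype.card V * inner (c.rep w) + (E (c.rep w) : ℕ) := by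
      intro v w h
      have h1 := Nat.mul_le_mul_left (Fintype.card V) (Nat.succ_le_of_lt h)
      rw [Nat.mul_succ] at h1
      have h2 := (E (c.rep v)).isLt
      omega
    refine ⟨fun v => Fintype.card V * inner (c.rep v) + (E (c.rep v) : ℕ), fun v w => ⟨fun h => ?_,
      fun h => by simp only [h]⟩, fun v w h => ?_⟩
    · rcases lt_trichotomy (inner (c.rep v)) (inner (c.rep w)) with h1 | h1 | h1
      · exact absurd h (hlt v w h1).ne
      · simp only [h1, add_right_inj] at h
        exact E.injective (Fin.ext h)
      · exact absurd h (hlt w v h1).ne'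
    · by_contra h1
      exact absurd h (not_lt.2 (hlt w v (not_le.1 h1)).le)
  have hkey : Function.Injective (c.key B J) :=
    Equiv.Perm.CycleCoordinates.key_injective h5 hJ
  set off := trailOffset (c.key B J) len with hoff
  have hle : ∀ v w, c.key B J v < c.key B J w → off v + len v ≤ off w :=
    fun v w => trailOffset_add_len_le (c.key B J) len
  refine ⟨off, fun v => decide (c.idx v % 2 = 1), fun v w hvw => ?_,
    trailOffset_add_len_le_sum _ _, ?_⟩
  · exact (lt_or_gt_of_ne (hkey.ne hvw)).imp (hle v w) (hle w v)
  set S : V → ℤ := fun v => -(inner v : ℤ) +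
        (if decide (c.idx v % 2 = 1) then -((off v : ℤ) + 1) else (off v : ℤ) + len v) +
        (if decide (c.idx (τ.symm v) % 2 = 1) then (off (τ.symm v) : ℤ) + len (τ.symm v)
          else -((off (τ.symm v) : ℤ) + 1)) with hS
  have hsource : ∀ v, c.idx v % 2 = 1 →
      S v = -(inner v : ℤ) - (off v + 1) - (off (τ.symm v) + 1) := by
    intro v hv
    have h1 : c.idx (τ.symm v) % 2 ≠ 1 := by
      rw [c.idx_symm, if_neg (by omega)]
      omega
    simp only [hS, hv, h1, decide_true, decide_false, if_true, Bool.false_eq_true, if_false]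
    ring
  have hsink : ∀ v, c.idx v % 2 = 0 → (c.idx v = 0 → c.per v % 2 = 0) →
      S v = -(inner v : ℤ) + (off v + len v) + (off (τ.symm v) + len (τ.symm v)) := by
    intro v hv hv'
    have h0 := h5 v
    have h1 : c.idx (τ.symm v) % 2 = 1 := by
      rw [c.idx_symm]
      split_ifs with h
      · have := hv' h
        omega
      · omega
    have h2 : c.idx v % 2 ≠ 1 := by omega
    simp only [hS, h2, h1, decide_true, decide_false, if_true, Bool.false_eq_true, if_false]
  -- As `len v = 1`, the entering label is `off v + 1`, and its 1 cancels against that of the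
  -- leaving label.
  have hexc : ∀ v, c.idx v = 0 → c.per v % 2 = 1 →
      S v = -(inner v : ℤ) + off v - off (τ.symm v) := by
    intro v hv hv'
    have h1 : c.idx (τ.symm v) % 2 ≠ 1 := by
      rw [c.idx_symm, if_pos hv]
      omega
    have h2 : c.idx v % 2 ≠ 1 := by omega
    have h3 : len v = 1 := by rw [← c.rep_of_idx v hv]; exact hone' v
    simp only [hS, h2, h1, decide_false, Bool.false_eq_true, if_false, h3]
    push_cast
    ring
  have hexc_neg : ∀ v, c.idx v = 0 → c.per v % 2 = 1 → off v + 1 ≤ off (τ.symm v) := by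
    intro v hv hv'
    have h1 := hle v (τ.symm v) (Equiv.Perm.CycleCoordinates.key_lt_iff.2 (Or.inl (by
      rw [(Equiv.Perm.CycleCoordinates.layer_side_symm h5 hv hv').1,
        (Equiv.Perm.CycleCoordinates.layer_side_eq_zero hv hv').1]
      exact one_pos)))
    have h2 := hpos v
    omega
  have hcases : ∀ v, c.idx v % 2 = 1 ∨ (c.idx v % 2 = 0 ∧ (c.idx v = 0 → c.per v % 2 = 0)) ∨
      (c.idx v = 0 ∧ c.per v % 2 = 1) := fun v => by omega
  have hsink_exc : ∀ v w, c.idx v % 2 = 0 → (c.idx v = 0 → c.per v % 2 = 0) →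
      c.idx w = 0 → c.per w % 2 = 1 → S w < S v := by
    intro v w h1 h2 h3 h4
    rw [hsink v h1 h2, hexc w h3 h4]
    have := hexc_neg w h3 h4
    have := hpos v
    have := hpos (τ.symm v)
    rcases hinner v with h | h <;> rcases hinner w with h' | h' <;> omega
  have hexc_source : ∀ v w, c.idx v = 0 → c.per v % 2 = 1 → c.idx w % 2 = 1 → S w < S v := by
    intro v w h1 h2 h3
    rw [hexc v h1 h2, hsource w h3]
    have h4 := (Equiv.Perm.CycleCoordinates.key_symm_lt_of_odd h5 hB h1 h2 h3).imp
      (hle _ _) (hle _ _)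
    have := hpos (τ.symm v)
    rcases hinner v with h | h <;> rcases hinner w with h' | h' <;> omega
  have hsink_source : ∀ v w, c.idx v % 2 = 0 → (c.idx v = 0 → c.per v % 2 = 0) →
      c.idx w % 2 = 1 → S w < S v := by
    intro v w h1 h2 h3
    rw [hsink v h1 h2, hsource w h3]
    rcases hinner v with h | h <;> rcases hinner w with h' | h' <;> omega
  -- Each match contributes a positive length, so the gap is at least 2 and survives a difference of
  -- 1 in `inner`.
  have hpair : ∀ v w, PairLT (c.key B J (τ.symm v)) (c.key B J v) (c.key B J (τ.symm w))
      (c.key B J w) → off v + len v + (off (τ.symm v) + len (τ.symm v)) ≤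
        off w + off (τ.symm w) := by
    rintro v w (⟨h1, h2⟩ | ⟨h1, h2⟩)
    all_goals
      have h3 := hle _ _ h1
      have h4 := hle _ _ h2
      omega
  intro v w hvw
  by_contra hne
  change S v = S w at hvw
  rcases hcases v with hv | ⟨hv, hv'⟩ | ⟨hv, hv'⟩ <;> rcases hcases w with hw | ⟨hw, hw'⟩ | ⟨hw, hw'⟩
  · have h1 := (Equiv.Perm.CycleCoordinates.key_pairLT h5 hB hJ hne (by omega) (by omega)
      (by omega)).imp (hpair v w) (hpair w v)
    rw [hsource v hv, hsource w hw] at hvw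
    have := hpos v
    have := hpos w
    have := hpos (τ.symm v)
    have := hpos (τ.symm w)
    rcases hinner v with h | h <;> rcases hinner w with h' | h' <;> omega
  · exact absurd hvw (hsink_source w v hw hw' hv).ne
  · exact absurd hvw (hexc_source w v hw hw' hv).ne
  · exact absurd hvw (hsink_source v w hv hv' hw).ne'
  · have h1 := (Equiv.Perm.CycleCoordinates.key_pairLT h5 hB hJ hne (by omega) hv'
      hw').imp (hpair v w) (hpair w v)
    rw [hsink v hv hv', hsink w hw hw'] at hvw
    have := hpos v
    have := hpos w
    have := hpos (τ.symm v)
    have := hpos (τ.symm w)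
    rcases hinner v with h | h <;> rcases hinner w with h' | h' <;> omega
  · exact absurd hvw (hsink_exc v w hv hv' hw hw').ne'
  · exact absurd hvw (hexc_source v w hv hv' hw).ne'
  · exact absurd hvw (hsink_exc w v hw hw' hv hv').ne
  · have hlt : ∀ v w, c.idx v = 0 → c.per v % 2 = 1 → c.idx w = 0 → c.per w % 2 = 1 →
        J v < J w → S w < S v := by
      intro v w hv hv' hw hw' hlt
      have h1 := Equiv.Perm.CycleCoordinates.trailOffset_growth h5 hB hJ hpos hone' hv hv' hw hw' hlt
      have h2 := hJi v w hlt
      rw [c.rep_of_idx v hv, c.rep_of_idx w hw] at h2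
      rw [hexc v hv hv', hexc w hw hw']
      rw [← hoff] at h1
      omega
    rcases lt_trichotomy (J v) (J w) with h | h | h
    · exact absurd hvw (hlt v w hv hv' hw hw' h).ne'
    · exact hne (c.ext v w ((hJ v w).1 h) (hv.trans hw.symm))
    · exact absurd hvw (hlt w v hw hw' hv hv' h).ne

/-! ### From labelled trails to an antimagic orientation. -/

/-- An indexed family of arcs and labels describes an antimagic orientation. -/
theorem SimpleGraph.hasAntimagicOrientation_of_arcs {V I : Type*} [Fintype V] [DecidableEq V]
    [Fintype I] (G : SimpleGraph V) (tail head : I → V) (lab : I → ℕ)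
    (hadj : ∀ i, G.Adj (tail i) (head i))
    (hinj : ∀ i j, s(tail i, head i) = s(tail j, head j) → i = j)
    (hsurj : ∀ u w, G.Adj u w → ∃ i, s(tail i, head i) = s(u, w))
    (hlab : Function.Injective lab) (hrange : ∀ i, lab i ∈ Finset.Icc 1 (Fintype.card I))
    (hS : Function.Injective fun u => ∑ i, ((if head i = u then (lab i : ℤ) else 0) -
      if tail i = u then (lab i : ℤ) else 0)) : G.HasAntimagicOrientation := by
  classical
  let arc : I → V × V := fun i => (tail i, head i)
  have harc : Function.Injective arc := fun i j h => hinj i j (by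
    obtain ⟨h1, h2⟩ := Prod.mk.inj h
    rw [h1, h2])
  let D : Digraph V := ⟨fun u w => ∃ i, arc i = (u, w)⟩
  let c : V × V → ℕ := Function.extend arc lab 0
  have hc : ∀ i, c (tail i, head i) = lab i := harc.extend_apply lab 0
  have hset : D.arcSet = Set.range arc := rfl
  have hcard : D.arcSet.ncard = Fintype.card I := by
    rw [hset, ← Nat.card_coe_set_eq, Nat.card_range_of_injective harc, Nat.card_eq_fintype_card]
  have himage : Finset.univ.image lab = Finset.Icc 1 (Fintype.card I) := by
    apply Finset.eq_of_subset_of_card_le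
    · intro n hn
      obtain ⟨i, -, rfl⟩ := Finset.mem_image.1 hn
      exact hrange i
    · rw [Finset.card_image_of_injective _ hlab, Nat.card_Icc, Finset.card_univ]
      omega
  refine ⟨D, ⟨fun u w => ⟨fun h => ?_, ?_⟩, ?_⟩, c, ⟨?_, ?_, ?_⟩, ?_⟩
  · obtain ⟨i, hi⟩ := hsurj u w h
    rcases Sym2.eq_iff.1 hi with ⟨rfl, rfl⟩ | ⟨rfl, rfl⟩
    · exact Or.inl ⟨i, rfl⟩
    · exact Or.inr ⟨i, rfl⟩
  · rintro (⟨i, hi⟩ | ⟨i, hi⟩)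
    · obtain ⟨rfl, rfl⟩ := Prod.mk.inj hi
      exact hadj i
    · obtain ⟨rfl, rfl⟩ := Prod.mk.inj hi
      exact (hadj i).symm
  · rintro u w ⟨i, hi⟩ ⟨j, hj⟩
    obtain ⟨rfl, rfl⟩ := Prod.mk.inj hi
    obtain ⟨h1, h2⟩ := Prod.mk.inj hj
    obtain rfl := hinj i j (by rw [h1, h2, Sym2.eq_swap])
    exact (hadj i).ne h1
  · rw [hcard, hset]
    rintro _ ⟨i, rfl⟩
    exact (hc i).symm ▸ (by simpa using hrange i)
  · rw [hset]
    rintro _ ⟨i, rfl⟩ _ ⟨j, rfl⟩ h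
    exact congrArg arc (hlab ((hc i).symm.trans (h.trans (hc j))))
  · intro n hn
    rw [hcard, ← Finset.coe_Icc, ← himage] at hn
    obtain ⟨i, -, rfl⟩ := Finset.mem_image.1 (Finset.mem_coe.1 hn)
    exact ⟨arc i, ⟨i, rfl⟩, hc i⟩
  · convert hS using 1
    ext u
    rw [Finset.sum_sub_distrib, ← Finset.sum_filter, ← Finset.sum_filter]
    unfold Digraph.vertexSum
    congr 1
    · trans ∑ w ∈ (Finset.univ.filter fun i => head i = u).image tail, (c (w, u) : ℤ)
      · refine Finset.sum_congr ?_ fun _ _ => rfl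
        ext w
        simp only [D, arc, Finset.mem_filter, Finset.mem_univ, true_and, Finset.mem_image,
          Prod.mk.injEq]
        exact exists_congr fun i => and_comm
      rw [Finset.sum_image]
      · refine Finset.sum_congr rfl fun i hi => ?_
        rw [← (Finset.mem_filter.1 hi).2, hc]
      · intro i hi j hj h
        refine harc (Prod.ext h ?_)
        exact (Finset.mem_filter.1 (Finset.mem_coe.1 hi)).2.trans
          (Finset.mem_filter.1 (Finset.mem_coe.1 hj)).2.symm
    · trans ∑ w ∈ (Finset.univ.filter fun i => tail i = u).image head, (c (u, w) : ℤ)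
      · refine Finset.sum_congr ?_ fun _ _ => rfl
        ext w
        simp only [D, arc, Finset.mem_filter, Finset.mem_univ, true_and, Finset.mem_image,
          Prod.mk.injEq]
      rw [Finset.sum_image]
      · refine Finset.sum_congr rfl fun i hi => ?_
        rw [← (Finset.mem_filter.1 hi).2, hc]
      · intro i hi j hj h
        refine harc (Prod.ext ?_ h)
        exact (Finset.mem_filter.1 (Finset.mem_coe.1 hi)).2.trans
          (Finset.mem_filter.1 (Finset.mem_coe.1 hj)).2.symm

section TrailSum

variable {V : Type*} [DecidableEq V] (p : ℕ → V) (u : V)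

/-- The contribution to the vertex sum at `u` of a trail whose labels increase by one along the
trail. -/
theorem trail_sum_forward (o : ℤ) (n : ℕ) :
    ∑ j ∈ Finset.range (n + 1), ((if p (j + 1) = u then o + j + 1 else 0) -
      if p j = u then o + j + 1 else 0) =
    (if p (n + 1) = u then o + n + 1 else 0) - (if p 0 = u then o + 1 else 0) -
      ∑ j ∈ Finset.range n, if p (j + 1) = u then 1 else 0 := by
  induction n with
  | zero => simp
  | succ n ih =>
    rw [Finset.sum_range_succ, ih, Finset.sum_range_succ _ n]
    push_cast
    split_ifs <;> ring

/-- The contribution to the vertex sum at `u` of a reversed trail whose labels increase by one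
along the reversed trail. -/
theorem trail_sum_backward (o : ℤ) (n : ℕ) :
    ∑ j ∈ Finset.range (n + 1), ((if p j = u then o + (n + 1 - j) else 0) -
      if p (j + 1) = u then o + (n + 1 - j) else 0) =
    (if p 0 = u then o + n + 1 else 0) - (if p (n + 1) = u then o + 1 else 0) -
      ∑ j ∈ Finset.range n, if p (j + 1) = u then 1 else 0 := by
  induction n generalizing o with
  | zero => simp
  | succ n ih =>
    -- One more edge at the end of the trail raises all earlier labels by one, hence the induction
    -- over all `o`.
    have h : ∀ j : ℕ, o + (((n + 1 : ℕ) : ℤ) + 1 - j) = (o + 1) + (n + 1 - j) := fun j => by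
      push_cast
      ring
    simp only [h]
    rw [Finset.sum_range_succ, ih, Finset.sum_range_succ _ n]
    push_cast
    split_ifs <;> ring

theorem trail_incidence_sum (n : ℕ) :
    ∑ j ∈ Finset.range (n + 1), ((if p j = u then 1 else 0) + if p (j + 1) = u then 1 else 0) =
    (if p 0 = u then 1 else 0) + (if p (n + 1) = u then 1 else 0) +
      2 * ∑ j ∈ Finset.range n, if p (j + 1) = u then 1 else 0 := by
  rw [Finset.sum_add_distrib, Finset.sum_range_succ', Finset.sum_range_succ _ n]
  ring

end TrailSum

namespace SimpleGraph.TrailSystem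

variable {V : Type*} {G : SimpleGraph V} (T : G.TrailSystem)

theorem len_sub_one_add_one (v : V) : T.len v - 1 + 1 = T.len v :=
  Nat.sub_add_cancel (T.len_pos v)

/-- The edges of `G`, as pairs of a trail and a position in this trail. -/
abbrev Position : Type _ := Σ v, Fin (T.len v)

theorem card_position [Fintype V] : Fintype.card T.Position = ∑ v, T.len v := by
  simp

variable [Fintype V] [DecidableEq V]

/-- The number of passages of trails through the vertex `u`. -/
def inner (u : V) : ℕ :=
  ∑ v, ∑ j ∈ Finset.range (T.len v - 1), if T.path v (j + 1) = u then 1 else 0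

/-- Every passage uses two edges at `u`; the trail starting and the trail ending there add one each.
-/
theorem degree_eq [DecidableRel G.Adj] (u : V) : G.degree u = 2 * T.inner u + 2 := by
  let edge : T.Position → Sym2 V := fun x => s(T.path x.1 x.2, T.path x.1 (x.2 + 1))
  have hinj : Function.Injective edge := by
    rintro ⟨v, i⟩ ⟨w, j⟩ h
    obtain ⟨rfl, hij⟩ := T.edge_inj v w i j i.2 j.2 h
    rw [Fin.ext hij]
  have himage : G.incidenceFinset u = (Finset.univ.filter fun x => u ∈ edge x).image edge := by
    ext e
    simp only [mem_incidenceFinset, Finset.mem_image, Finset.mem_filter, Finset.mem_univ, true_and]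
    constructor
    · rintro ⟨h1, h2⟩
      induction e with
      | _ a b =>
        obtain ⟨v, i, hi, h⟩ := T.edge_surj a b h1
        exact ⟨⟨v, i, hi⟩, by rw [show edge ⟨v, i, hi⟩ = s(a, b) from h]; exact h2, h⟩
    · rintro ⟨x, hx, rfl⟩
      exact ⟨T.adj x.1 x.2 x.2.2, hx⟩
  rw [← card_incidenceFinset_eq_degree, himage, Finset.card_image_of_injective _ hinj,
    Finset.card_filter]
  have hterm : ∀ x : T.Position, (if u ∈ edge x then 1 else 0) =
      (if T.path x.1 x.2 = u then 1 else 0) + if T.path x.1 (x.2 + 1) = u then 1 else 0 := by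
    intro x
    have hne := (T.adj x.1 x.2 x.2.2).ne
    simp only [edge, Sym2.mem_iff]
    by_cases h1 : T.path x.1 x.2 = u
    · have h2 : T.path x.1 (x.2 + 1) ≠ u := fun h2 => hne (h1.trans h2.symm)
      simp [h1, h2]
    · by_cases h2 : T.path x.1 (x.2 + 1) = u
      · simp [h1, h2]
      · simp [h1, h2, Ne.symm h1, Ne.symm h2]
  rw [Finset.sum_congr rfl fun x _ => hterm x, Fintype.sum_sigma]
  have htrail : ∀ v, ∑ i : Fin (T.len v), ((if T.path v i = u then 1 else 0) +
      if T.path v (i + 1) = u then 1 else 0) = (if v = u then 1 else 0) +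
      (if v = T.next.symm u then 1 else 0) +
        2 * ∑ j ∈ Finset.range (T.len v - 1), if T.path v (j + 1) = u then 1 else 0 := by
    intro v
    rw [Fin.sum_univ_eq_sum_range (fun i => (if T.path v i = u then 1 else 0) +
      if T.path v (i + 1) = u then 1 else 0), ← T.len_sub_one_add_one v, trail_incidence_sum,
      T.len_sub_one_add_one, T.path_zero, T.path_len]
    simp only [Equiv.eq_symm_apply]
  rw [Finset.sum_congr rfl fun v _ => htrail v, Finset.sum_add_distrib, Finset.sum_add_distrib,
    ← Finset.mul_sum, Finset.sum_ite_eq' , Finset.sum_ite_eq', inner]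
  simp
  ring

/-- With blocks of labels increasing along the directed trails, the vertex sums become exactly the
expressions that `exists_trail_order` separates. -/
theorem hasAntimagicOrientation (e : ℕ) (hinner : ∀ v, T.inner v = e ∨ T.inner v = e + 1)
    (hcard : ∀ v, ∃ s : Finset V, 5 ≤ s.card ∧ ∀ w ∈ s, T.next.SameCycle v w) :
    G.HasAntimagicOrientation := by
  obtain ⟨off, fwd, hoff, hsum, hS⟩ :=
    T.next.exists_trail_order T.len T.inner e T.len_pos hinner T.exists_len_one hcard
  let tail : T.Position → V := fun x =>
    if fwd x.1 then T.path x.1 x.2 else T.path x.1 (x.2 + 1)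
  let head : T.Position → V := fun x =>
    if fwd x.1 then T.path x.1 (x.2 + 1) else T.path x.1 x.2
  let lab : T.Position → ℕ := fun x =>
    if fwd x.1 then off x.1 + x.2 + 1 else off x.1 + (T.len x.1 - x.2)
  have hedge : ∀ x, s(tail x, head x) = s(T.path x.1 x.2, T.path x.1 (x.2 + 1)) := by
    intro x
    simp only [tail, head]
    split_ifs
    · rfl
    · exact Sym2.eq_swap
  have hlab : ∀ x, off x.1 + 1 ≤ lab x ∧ lab x ≤ off x.1 + T.len x.1 := by
    intro x
    have := x.2.2
    simp only [lab]
    split_ifs <;> omega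
  refine G.hasAntimagicOrientation_of_arcs tail head lab (fun x => ?_) (fun x y h => ?_)
    (fun u w h => ?_) (fun x y h => ?_) (fun x => ?_) ?_
  · rw [← mem_edgeSet, hedge]
    exact T.adj x.1 x.2 x.2.2
  · rw [hedge, hedge] at h
    obtain ⟨v, i⟩ := x
    obtain ⟨w, j⟩ := y
    obtain ⟨rfl, hij⟩ := T.edge_inj v w i j i.2 j.2 h
    rw [Fin.ext hij]
  · obtain ⟨v, i, hi, h'⟩ := T.edge_surj u w h
    exact ⟨⟨v, i, hi⟩, by rw [hedge]; exact h'⟩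
  · have hx := hlab x
    have hy := hlab y
    obtain ⟨v, i⟩ := x
    obtain ⟨w, j⟩ := y
    obtain rfl : v = w := by
      by_contra hne
      have := hoff v w hne
      dsimp only at hx hy
      omega
    have hi := i.2
    have hj := j.2
    have : (i : ℕ) = j := by
      simp only [lab] at h
      split_ifs at h <;> omega
    rw [Fin.ext this]
  · rw [Finset.mem_Icc, card_position]
    have := hlab x
    have := hsum x.1
    omega
  · convert hS using 1
    ext u
    rw [Fintype.sum_sigma]
    have htrail : ∀ v, ∑ i : Fin (T.len v), ((if head ⟨v, i⟩ = u then (lab ⟨v, i⟩ : ℤ) else 0) -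
        if tail ⟨v, i⟩ = u then (lab ⟨v, i⟩ : ℤ) else 0) =
        (if v = u then if fwd v then -((off v : ℤ) + 1) else (off v : ℤ) + T.len v else 0) +
        (if v = T.next.symm u then if fwd v then (off v : ℤ) + T.len v
          else -((off v : ℤ) + 1) else 0) -
        ∑ j ∈ Finset.range (T.len v - 1), if T.path v (j + 1) = u then 1 else 0 := by
      intro v
      have hlen : ((T.len v - 1 : ℕ) : ℤ) + 1 = T.len v := by
        exact_mod_cast T.len_sub_one_add_one v
      simp only [head, tail, lab, Equiv.eq_symm_apply]
      by_cases hv : fwd v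
      · simp only [hv, if_true]
        have h := trail_sum_forward (T.path v) u (off v) (T.len v - 1)
        rw [T.len_sub_one_add_one, T.path_zero, T.path_len] at h
        rw [Fin.sum_univ_eq_sum_range (fun i => (if T.path v (i + 1) = u then
          ((off v + i + 1 : ℕ) : ℤ) else 0) - if T.path v i = u then
          ((off v + i + 1 : ℕ) : ℤ) else 0)]
        push_cast
        rw [h, add_assoc, hlen]
        split_ifs <;> ring
      · simp only [hv, if_false, Bool.false_eq_true]
        have h := trail_sum_backward (T.path v) u (off v) (T.len v - 1)
        rw [T.len_sub_one_add_one, T.path_zero, T.path_len] at h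
        rw [Fin.sum_univ_eq_sum_range (fun i => (if T.path v i = u then
          ((off v + (T.len v - i) : ℕ) : ℤ) else 0) - if T.path v (i + 1) = u then
          ((off v + (T.len v - i) : ℕ) : ℤ) else 0)]
        have hcast : ∀ i ∈ Finset.range (T.len v), ((off v + (T.len v - i) : ℕ) : ℤ) =
            (off v : ℤ) + (((T.len v - 1 : ℕ) : ℤ) + 1 - i) := by
          intro i hi
          have := Finset.mem_range.1 hi
          rw [hlen]
          omega
        rw [Finset.sum_congr rfl fun i hi => by rw [hcast i hi], h, add_assoc, hlen]
        split_ifs <;> ring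
    rw [Finset.sum_congr rfl fun v _ => htrail v, Finset.sum_sub_distrib, Finset.sum_add_distrib,
      Finset.sum_ite_eq', Finset.sum_ite_eq', inner]
    simp only [Finset.mem_univ, if_true]
    push_cast
    ring

end SimpleGraph.TrailSystem

theorem mainTheorem3 {V : Type*} [Fintype V] (G : SimpleGraph V) [DecidableRel G.Adj]
    (d : ℕ) (hd : 2 ≤ d) (hdeg : ∀ v : V, G.degree v = 2 * d ∨ G.degree v = 2 * d + 2) :
    G.HasAntimagicOrientation := by
  classical
  obtain ⟨T⟩ := G.nonempty_trailSystem
    (fun v => by rcases hdeg v with h | h <;> rw [h, Nat.even_iff] <;> omega)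
    (fun v => by rcases hdeg v with h | h <;> omega)
  -- A degree 2d or 2d+2 means d-1 or d passages; a closed neighbourhood supplies at least 2d+1 ≥ 5
  -- vertices of one cycle.
  refine T.hasAntimagicOrientation (d - 1) (fun v => ?_) fun v => ?_
  · have := T.degree_eq v
    rcases hdeg v with h | h <;> omega
  · refine ⟨insert v (G.neighborFinset v), ?_, fun w hw => ?_⟩
    · rw [Finset.card_insert_of_notMem (by simp), SimpleGraph.card_neighborFinset_eq_degree]
      rcases hdeg v with h | h <;> omega
    · rcases Finset.mem_insert.1 hw with rfl | hw
      · exact Equiv.Perm.SameCycle.refl _ _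
      · exact T.sameCycle v w ((G.mem_neighborFinset v w).1 hw)
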